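/- Let $\widetilde{\mathcal D}_1,\widetilde{\mathcal D}_2$ be triangulated categories in which all small coproducts exist, and let $\mathcal D_i\subset\widetilde{\mathcal D}_i$ ($i=1,2$) be full (strictly full) triangulated essentially small subcategories. Let $\Phi:\widetilde{\mathcal D}_1\to\widetilde{\mathcal D}_2$ be an exact functor commuting with small coproducts that admits a left adjoint $\Psi:\widetilde{\mathcal D}_2\to\widetilde{\mathcal D}_1$, and assume that $\Phi(\mathcal D_1)\subset\mathcal D_2$ and $\Psi(\mathcal D_2)\subset\mathcal D_1$. An exact functor between triangulated categories with $t$-structures is called left (resp. right) $t$-exact if it sends $\mathcal D^{\ge 0}$ to $\mathcal D^{\ge 0}$ (resp. $\mathcal D^{\le 0}$ to $\mathcal D^{\le 0}$), and $t$-exact if it is both. (i) Let $(\mathcal D_2^{\le 0},\mathcal D_2^{\ge 0})$ be a $t$-structure on $\mathcal D_2$ such that $\Phi\Psi:\mathcal D_2\to\mathcal D_2$ is right $t$-exact. Assume in addition that $\mathcal D_1=\Phi^{-1}(\mathcal D_2)$, i.e. every $F\in\widetilde{\mathcal D}_1$ with $\Phi(F)\in\mathcal D_2$ lies in $\mathcal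 D_1$. Then there exists a unique $t$-structure on $\mathcal D_1$ with $$\mathcal D_1^{\ge 0}=\{F\in\mathcal D_1 \mid \Phi(F)\in\mathcal D_2^{\ge 0}\}.$$ Moreover, the functor $\Phi:\mathcal D_1\to\mathcal D_2$ is $t$-exact with respect to these $t$-structures. (ii) Assume also that every $F\in\mathcal D_1$ with $\Phi(F)=0$ satisfies $F=0$. Then $$\mathcal D_1^{\le 0}=\{F\in\mathcal D_1 \mid \Phi(F)\in\mathcal D_2^{\le 0}\}.$$ In this situation, if the heart $\mathcal C_2=\mathcal D_2^{\le 0}\cap\mathcal D_2^{\ge 0}$ is Noetherian (every object satisfies the ascending chain condition on subobjects), then so is the heart $\mathcal C_1=\mathcal D_1^{\le 0}\cap\mathcal D_1^{\ge 0}$. -/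

import Mathlib

open CategoryTheory CategoryTheory.Limits CategoryTheory.Triangulated

universe w v₁ v₂ u₁ u₂

namespace InducedTStructure

section Restrict

variable {C : Type u₁} [Category.{v₁} C] {D : Type u₂} [Category.{v₂} D]
  {P : ObjectProperty C} {Q : ObjectProperty D}

/-- If `F : C ⥤ D` sends the full subcategory `P` into the full subcategory `Q`, this is the
functor `P ⥤ Q` that `F` induces. -/
abbrev restrict (F : C ⥤ D) (hF : ∀ X, P X → Q (F.obj X)) :
    P.FullSubcategory ⥤ Q.FullSubcategory :=
  Q.lift (P.ι ⋙ F) (fun X => hF X.obj X.property)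

end Restrict

section TExact

variable {C : Type u₁} [Category.{v₁} C] [Preadditive C] [HasZeroObject C] [HasShift C ℤ]
  [∀ n : ℤ, (shiftFunctor C n).Additive] [Pretriangulated C]
  {D : Type u₂} [Category.{v₂} D] [Preadditive D] [HasZeroObject D] [HasShift D ℤ]
  [∀ n : ℤ, (shiftFunctor D n).Additive] [Pretriangulated D]

/-- Left t-exactness of an exact functor `F`: `F` sends `C^{≥ 0}` into `D^{≥ 0}`. -/
def IsLeftTExact (F : C ⥤ D) (t : TStructure C) (t' : TStructure D) : Prop :=
  ∀ X : C, t.ge 0 X → t'.ge 0 (F.obj X)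

/-- Right t-exactness of an exact functor `F`: `F` sends `C^{≤ 0}` into `D^{≤ 0}`. -/
def IsRightTExact (F : C ⥤ D) (t : TStructure C) (t' : TStructure D) : Prop :=
  ∀ X : C, t.le 0 X → t'.le 0 (F.obj X)

/-- An exact functor is t-exact if it is both left and right t-exact. -/
def IsTExact (F : C ⥤ D) (t : TStructure C) (t' : TStructure D) : Prop :=
  IsLeftTExact F t t' ∧ IsRightTExact F t t'

/-- A t-structure is Noetherian if its heart `C^{≤ 0} ∩ C^{≥ 0}` is a Noetherian category: every
object of the heart satisfies the ascending chain condition on its subobjects in the heart. -/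
def IsNoetherian (t : TStructure C) : Prop :=
  ∀ X : t.heart.FullSubcategory, IsNoetherianObject X

end TExact

end InducedTStructure

namespace InducedTStructure

open Pretriangulated

/-! ### Exactness and fibers in distinguished triangles -/

section Triangles

variable {D : Type u₁} [Category.{v₁} D] [Preadditive D] [HasZeroObject D] [HasShift D ℤ]
  [∀ n : ℤ, (shiftFunctor D n).Additive] [Pretriangulated D]
  {X Y Z : D} {f : X ⟶ Y} {g : Y ⟶ Z} {h : Z ⟶ X⟦(1 : ℤ)⟧}
  (hT : Triangle.mk f g h ∈ distTriang D)

include hT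

/-! The aisle must be the left orthogonal of the prescribed coaisle, so only truncation triangles
are at stake. Write `φ`, `ψ` for the functors induced on the subcategories, and let `G ⟶ φ F ⟶ T` be
the truncation triangle of `φ F`, with `G ≤ 0` and `T ≥ 1`. Coning off the adjoint map `ψ G ⟶ F`
gives `F ⟶ F'`. Right exactness of `φ ψ` makes `φ F ⟶ φ F'` factor through `T`, a retract of `φ F'`
with connective complement (`exists_approximation_step`).

Iterating gives a sequence whose image under `Φ` is essentially constant with value `T`. As `Φ`
preserves coproducts, the homotopy colimit `B`, formed in the big category, satisfies `Φ B ≅ T`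
(`telescope_iso_of_factors`); hence `B` lies in `P₁` and in the coaisle. By adjunction each cone is
invisible to the coaisle, so the fiber of `F ⟶ B` is left orthogonal to it
(`exists_triangle_of_adjunction`).

For Noetherianity, a t-exact functor preserves monomorphisms of hearts and, when it kills no nonzero
object, reflects isomorphisms. Strictly increasing chains of subobjects therefore stay strict. -/

lemma distTriang_comp₁₂ : f ≫ g = 0 := comp_distTriang_mor_zero₁₂ _ hT

lemma distTriang_comp₂₃ : g ≫ h = 0 := comp_distTriang_mor_zero₂₃ _ hT

lemma distTriang_comp₃₁ : h ≫ f⟦(1 : ℤ)⟧' = 0 := comp_distTriang_mor_zero₃₁ _ hT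

lemma distTriang_exists_desc₂ {W : D} (k : Y ⟶ W) (hk : f ≫ k = 0) : ∃ l : Z ⟶ W, k = g ≫ l :=
  Triangle.yoneda_exact₂ _ hT k hk

lemma distTriang_exists_desc₃ {W : D} (k : Z ⟶ W) (hk : g ≫ k = 0) :
    ∃ l : X⟦(1 : ℤ)⟧ ⟶ W, k = h ≫ l :=
  Triangle.yoneda_exact₃ _ hT k hk

lemma distTriang_exists_desc₁ {W : D} (k : X⟦(1 : ℤ)⟧ ⟶ W) (hk : h ≫ k = 0) :
    ∃ l : Y⟦(1 : ℤ)⟧ ⟶ W, k = f⟦(1 : ℤ)⟧' ≫ l := by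
  obtain ⟨l, hl⟩ := distTriang_exists_desc₃ (rot_of_distTriang _ hT) k hk
  refine ⟨-l, hl.trans ?_⟩
  exact (Preadditive.neg_comp _ _).trans (Preadditive.comp_neg _ _).symm

lemma distTriang_exists_lift₂ {W : D} (k : W ⟶ Y) (hk : k ≫ g = 0) : ∃ l : W ⟶ X, k = l ≫ f :=
  Triangle.coyoneda_exact₂ _ hT k hk

lemma distTriang_exists_lift₃ {W : D} (k : W ⟶ Z) (hk : k ≫ h = 0) : ∃ l : W ⟶ Y, k = l ≫ g :=
  Triangle.coyoneda_exact₃ _ hT k hk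

lemma distTriang_exists_lift₁ {W : D} (k : W ⟶ X⟦(1 : ℤ)⟧) (hk : k ≫ f⟦(1 : ℤ)⟧' = 0) :
    ∃ l : W ⟶ Z, k = l ≫ h :=
  Triangle.coyoneda_exact₁ _ hT k hk

lemma distTriang_map {D' : Type u₂} [Category.{v₂} D'] [Preadditive D'] [HasZeroObject D']
    [HasShift D' ℤ] [∀ n : ℤ, (shiftFunctor D' n).Additive] [Pretriangulated D']
    (F : D ⥤ D') [F.CommShift ℤ] [F.IsTriangulated] :
    Triangle.mk (F.map f) (F.map g) (F.map h ≫ (F.commShiftIso (1 : ℤ)).hom.app X) ∈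
      distTriang D' :=
  F.map_distinguished _ hT

lemma distTriang_of_iso₃ {Z' : D} (e : Z' ≅ Z) {g' : Y ⟶ Z'} (he : g' ≫ e.hom = g) :
    Triangle.mk f g' (e.hom ≫ h) ∈ distTriang D := by
  refine isomorphic_distinguished _ hT _
    (Triangle.isoMk _ _ (Iso.refl _) (Iso.refl _) e ?_ ?_ ?_)
  · exact (Category.comp_id f).trans (Category.id_comp f).symm
  · exact he.trans (Category.id_comp g).symm
  · exact (congr((e.hom ≫ h) ≫ $((shiftFunctor D (1 : ℤ)).map_id X))).trans (Category.comp_id _)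

/-- Two fibers of the same morphism are isomorphic. -/
lemma distTriang_nonempty_fiber_iso {X' : D} {f' : X' ⟶ Y} {h' : Z ⟶ X'⟦(1 : ℤ)⟧}
    (hT' : Triangle.mk f' g h' ∈ distTriang D) : Nonempty (X ≅ X') := by
  have comm : g ≫ 𝟙 Z = 𝟙 Y ≫ g := by rw [Category.comp_id, Category.id_comp]
  obtain ⟨(a : X ⟶ X'), ha₁, ha₂⟩ := complete_distinguished_triangle_morphism₁ _ _ hT hT' (𝟙 Y) (𝟙 Z) comm
  let φ : Triangle.mk f g h ⟶ Triangle.mk f' g h' :=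
    { hom₁ := a, hom₂ := 𝟙 Y, hom₃ := 𝟙 Z, comm₁ := ha₁, comm₂ := comm, comm₃ := ha₂ }
  have : IsIso a := isIso₁_of_isIso₂₃ φ hT hT'
    (inferInstanceAs (IsIso (𝟙 Y))) (inferInstanceAs (IsIso (𝟙 Z)))
  exact ⟨asIso a⟩

end Triangles

section ShiftHom

variable {D : Type u₁} [Category.{v₁} D] [HasShift D ℤ]

/-- The bijection between morphisms `X⟦1⟧ ⟶ Y` and morphisms `X ⟶ Y⟦-1⟧`. -/
noncomputable def shiftOneHomEquiv (X Y : D) : (X⟦(1 : ℤ)⟧ ⟶ Y) ≃ (X ⟶ Y⟦(-1 : ℤ)⟧) :=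
  (shiftEquiv D (1 : ℤ)).toAdjunction.homEquiv X Y

lemma shiftOneHomEquiv_comp {X X' Y : D} (f : X' ⟶ X) (k : X⟦(1 : ℤ)⟧ ⟶ Y) :
    shiftOneHomEquiv X' Y (f⟦(1 : ℤ)⟧' ≫ k) = f ≫ shiftOneHomEquiv X Y k :=
  Adjunction.homEquiv_naturality_left (shiftEquiv D (1 : ℤ)).toAdjunction f k

lemma shiftOneHomEquiv_zero [Preadditive D] [∀ n : ℤ, (shiftFunctor D n).Additive] (X Y : D) :
    shiftOneHomEquiv X Y 0 = 0 := by
  simpa using shiftOneHomEquiv_comp (0 : X ⟶ X) (0 : X⟦(1 : ℤ)⟧ ⟶ Y)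

end ShiftHom

/-! ### Homotopy colimits of sequences -/

section Telescope

variable {D : Type u₁} [Category.{v₁} D] [Preadditive D] {X : ℕ → D} {j : ∀ n, X n ⟶ X (n + 1)}
  {c : Cofan X} (hc : IsColimit c) {f : c.pt ⟶ c.pt}
  (hf : ∀ n, c.inj n ≫ f = c.inj n - j n ≫ c.inj (n + 1))

include hc hf

/-- The endomorphism `1 - shift` of a countable coproduct is surjective on morphisms to `C` if
each transition map is. -/
lemma telescope_exists_comp_eq {C : D} (hs : ∀ n (k : X n ⟶ C), ∃ k', j n ≫ k' = k)
    (v : c.pt ⟶ C) : ∃ u, f ≫ u = v := by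
  choose ext hext using hs
  -- On the `n`-th summand `f ≫ u = v` reads `k n - j n ≫ k (n + 1) = c.inj n ≫ v`. This is solved
  -- recursively; `k 0` is free, so it is taken to be `0`.
  let k : ∀ n, X n ⟶ C := fun n => Nat.rec 0 (fun n k => ext n (k - c.inj n ≫ v)) n
  have hk (n : ℕ) : j n ≫ k (n + 1) = k n - c.inj n ≫ v := hext _ _
  refine ⟨Cofan.IsColimit.desc hc k, Cofan.IsColimit.hom_ext hc _ _ fun n => ?_⟩
  have h := congr($(hf n) ≫ Cofan.IsColimit.desc hc k)
  simp only [Category.assoc, Preadditive.sub_comp, Cofan.IsColimit.fac, hk] at h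
  rw [h]; abel

variable [HasZeroObject D] [HasShift D ℤ] [∀ n : ℤ, (shiftFunctor D n).Additive]
  [Pretriangulated D] {H : D} {g : c.pt ⟶ H} {h : H ⟶ c.pt⟦(1 : ℤ)⟧}
  (hT : Triangle.mk f g h ∈ distTriang D)

include hT

omit hc in
lemma telescope_inj_comp (n : ℕ) : j n ≫ c.inj (n + 1) ≫ g = c.inj n ≫ g := by
  have h0 : f ≫ g = 0 := distTriang_comp₁₂ hT
  have h1 := congr($(hf n) ≫ g)
  simp only [Category.assoc, Preadditive.sub_comp, h0, comp_zero] at h1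
  exact (sub_eq_zero.1 h1.symm).symm

/-- Morphisms from the first object extend to the homotopy colimit if they extend along each
transition map. -/
lemma telescope_exists_extension {C : D} (hs : ∀ n (k : X n ⟶ C), ∃ k', j n ≫ k' = k)
    (k₀ : X 0 ⟶ C) : ∃ u, (c.inj 0 ≫ g) ≫ u = k₀ := by
  choose ext hext using hs
  let k : ∀ n, X n ⟶ C := fun n => Nat.rec k₀ (fun n k => ext n k) n
  have hk (n : ℕ) : j n ≫ k (n + 1) = k n := hext _ _
  have h0 : f ≫ Cofan.IsColimit.desc hc k = 0 := by
    refine Cofan.IsColimit.hom_ext hc _ _ fun n => ?_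
    have h := congr($(hf n) ≫ Cofan.IsColimit.desc hc k)
    simp only [Category.assoc, Preadditive.sub_comp, Cofan.IsColimit.fac, hk, sub_self] at h
    rw [h, comp_zero]
  obtain ⟨u, hu⟩ := distTriang_exists_desc₂ hT (Cofan.IsColimit.desc hc k) h0
  refine ⟨u, ?_⟩
  rw [Category.assoc, ← hu, Cofan.IsColimit.fac]
  rfl

/-- A morphism from the homotopy colimit that vanishes on the first object is zero, if restriction
along the transition maps is injective on morphisms to `C` and surjective on morphisms to
`C⟦-1⟧`. -/
lemma telescope_eq_zero {C : D} (hi : ∀ n (k : X (n + 1) ⟶ C), j n ≫ k = 0 → k = 0)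
    (hs : ∀ n (k : X n ⟶ C⟦(-1 : ℤ)⟧), ∃ k', j n ≫ k' = k)
    (u : H ⟶ C) (hu : (c.inj 0 ≫ g) ≫ u = 0) : u = 0 := by
  have hgu (n : ℕ) : c.inj n ≫ g ≫ u = 0 := by
    induction n with
    | zero => simpa using hu
    | succ n ih =>
      apply hi
      have := congr($(telescope_inj_comp hf hT n) ≫ u)
      simp only [Category.assoc] at this
      rw [this, ih]
  have h0 : g ≫ u = 0 := Cofan.IsColimit.hom_ext hc _ _ fun n => by rw [hgu, comp_zero]
  obtain ⟨v, hv⟩ := distTriang_exists_desc₃ hT u h0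
  -- Vanishing of the `lim¹` term: after desuspension `v` factors through `1 - shift`, so `v`
  -- factors through `f⟦1⟧`, which `h` kills.
  obtain ⟨y, hy⟩ := telescope_exists_comp_eq hc hf hs (shiftOneHomEquiv _ _ v)
  obtain ⟨y, rfl⟩ := (shiftOneHomEquiv _ _).surjective y
  rw [← shiftOneHomEquiv_comp, EmbeddingLike.apply_eq_iff_eq] at hy
  rw [hv, ← hy, reassoc_of% (distTriang_comp₃₁ hT), zero_comp]

/-- If the transition maps factor through a fixed object `T` as in an essentially constant system,
then the homotopy colimit is `T`. -/
lemma telescope_iso_of_factors {T : D} (s : ∀ n, X n ⟶ T) (σ : ∀ n, T ⟶ X (n + 1))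
    (hj : ∀ n, j n = s n ≫ σ n) (hσ : ∀ n, σ n ≫ s (n + 1) = 𝟙 T) :
    ∃ e : H ≅ T, (c.inj 0 ≫ g) ≫ e.hom = s 0 := by
  have hjs (n : ℕ) : j n ≫ s (n + 1) = s n := by rw [hj, Category.assoc, hσ, Category.comp_id]
  -- An explicit retraction of `1 - shift`; the auxiliary `v n` is minus the sum of `σ m ≫ c.inj (m
  -- + 1)` over `m < n`. It makes `g` epi, so maps out of `H` are determined on the `X n`.
  obtain ⟨r, hr⟩ : ∃ r, f ≫ r = 𝟙 c.pt := by
    let v : ∀ n : ℕ, T ⟶ c.pt := fun n =>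
      Nat.rec 0 (fun n v => v - σ n ≫ c.inj (n + 1)) n
    have hv (n : ℕ) : v (n + 1) = v n - σ n ≫ c.inj (n + 1) := rfl
    let k : ∀ n, X n ⟶ c.pt := fun n => c.inj n + s n ≫ v n
    refine ⟨Cofan.IsColimit.desc hc k, Cofan.IsColimit.hom_ext hc _ _ fun n => ?_⟩
    have h := congr($(hf n) ≫ Cofan.IsColimit.desc hc k)
    simp only [Category.assoc, Preadditive.sub_comp, Cofan.IsColimit.fac, k, hj, hv,
      Preadditive.comp_add, Preadditive.comp_sub, reassoc_of% hσ] at h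
    rw [h, Category.comp_id]; abel
  have : Mono f := mono_of_mono_fac hr
  have hg : Epi g := Triangle.epi₂ _ hT (Triangle.mor₃_eq_zero_of_mono₁ _ hT this)
  have hs0 : f ≫ Cofan.IsColimit.desc hc s = 0 := by
    refine Cofan.IsColimit.hom_ext hc _ _ fun n => ?_
    have h := congr($(hf n) ≫ Cofan.IsColimit.desc hc s)
    simp only [Category.assoc, Preadditive.sub_comp, Cofan.IsColimit.fac, hjs, sub_self] at h
    rw [h, comp_zero]
  obtain ⟨a, ha⟩ := distTriang_exists_desc₂ hT (Cofan.IsColimit.desc hc s) hs0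
  have hga (n : ℕ) : c.inj n ≫ g ≫ a = s n := by rw [← ha, Cofan.IsColimit.fac]
  have htel := telescope_inj_comp hf hT
  -- The maps `T ⟶ X (n + 1) ⟶ H` are independent of `n`; their common value is the inverse.
  have hc1 (n : ℕ) : σ n ≫ c.inj (n + 1) ≫ g = σ 0 ≫ c.inj 1 ≫ g := by
    induction n with
    | zero => rfl
    | succ n ih => rw [← ih, ← htel (n + 1), hj (n + 1), Category.assoc, reassoc_of% (hσ n)]
  refine ⟨⟨a, σ 0 ≫ c.inj 1 ≫ g, ?_, ?_⟩, by rw [Category.assoc, hga]⟩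
  · rw [← cancel_epi g]
    refine Cofan.IsColimit.hom_ext hc _ _ fun n => ?_
    rw [← Category.assoc g a, ← Category.assoc (c.inj n), hga, Category.comp_id, ← htel n,
      hj n, Category.assoc, hc1 n]
  · rw [Category.assoc, Category.assoc, hga, hσ]

end Telescope

/-! ### Morphisms with connective fiber -/

section Coaisle

variable {D : Type u₁} [Category.{v₁} D] [Preadditive D] [HasZeroObject D] [HasShift D ℤ]
  [∀ n : ℤ, (shiftFunctor D n).Additive] [Pretriangulated D] (t : TStructure D)

/-- `s : X ⟶ T` is part of a distinguished triangle `G ⟶ X ⟶ T ⟶ G⟦1⟧` with `G ≤ 0`. -/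
def HasConnectiveFiber {X T : D} (s : X ⟶ T) : Prop :=
  ∃ (G : D) (i : G ⟶ X) (δ : T ⟶ G⟦(1 : ℤ)⟧), t.le 0 G ∧ Triangle.mk i s δ ∈ distTriang D

variable {t}

lemma HasConnectiveFiber.of_iso {X T T' : D} {s : X ⟶ T} {s' : X ⟶ T'}
    (hs : HasConnectiveFiber t s) (e : T' ≅ T) (he : s' ≫ e.hom = s) :
    HasConnectiveFiber t s' := by
  obtain ⟨G, i, δ, hG, hT⟩ := hs
  exact ⟨G, i, e.hom ≫ δ, hG, distTriang_of_iso₃ hT e he⟩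

lemma HasConnectiveFiber.le_of_distTriang {A X T : D} {i : A ⟶ X} {s : X ⟶ T}
    {δ : T ⟶ A⟦(1 : ℤ)⟧} (hs : HasConnectiveFiber t s) (hT : Triangle.mk i s δ ∈ distTriang D) :
    t.le 0 A := by
  obtain ⟨G, i', δ', hG, hT'⟩ := hs
  obtain ⟨e⟩ := distTriang_nonempty_fiber_iso hT' hT
  exact (t.le 0).prop_of_iso e hG

lemma le_zero_shift_one {G : D} (hG : t.le 0 G) : t.le 0 (G⟦(1 : ℤ)⟧) :=
  t.le_monotone (by lia : (-1 : ℤ) ≤ 0) _ (t.le_shift 0 1 (-1) (by lia) _ hG)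

/-- A morphism `s : X ⟶ T` with connective fiber, `T ≥ 1`, can be modified by coning off any
`L ⟶ X` with `L ≤ 0` through which the fiber of `s` factors. -/
lemma HasConnectiveFiber.exists_of_cone {X T L X' : D} {s : X ⟶ T}
    (hs : HasConnectiveFiber t s) (hT : t.ge 1 T)
    {ℓ : L ⟶ X} {j : X ⟶ X'} {δ : X' ⟶ L⟦(1 : ℤ)⟧} (hL : t.le 0 L)
    (htri : Triangle.mk ℓ j δ ∈ distTriang D)
    (hj : ∀ (G : D) (i : G ⟶ X), t.le 0 G → i ≫ j = 0) :
    ∃ (s' : X' ⟶ T) (σ : T ⟶ X'), HasConnectiveFiber t s' ∧ j = s ≫ σ ∧ σ ≫ s' = 𝟙 T := by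
  obtain ⟨G, i, δ', hG, htri'⟩ := hs
  obtain ⟨σ, hσ⟩ := distTriang_exists_desc₂ htri' j (hj G i hG)
  obtain ⟨s', hs'⟩ := distTriang_exists_desc₂ htri s (t.zero' _ hL hT)
  have hσs : σ ≫ s' = 𝟙 T := by
    have h0 : s ≫ (σ ≫ s' - 𝟙 T) = 0 := by
      rw [Preadditive.comp_sub, ← Category.assoc, ← hσ, ← hs', Category.comp_id, sub_self]
    obtain ⟨u, hu⟩ := distTriang_exists_desc₃ htri' _ h0
    rw [t.zero' u (le_zero_shift_one hG) hT, comp_zero] at hu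
    exact sub_eq_zero.1 hu
  refine ⟨s', σ, ?_, hσ, hσs⟩
  obtain ⟨G', i', δ'', htri''⟩ := distinguished_cocone_triangle₁ s'
  refine ⟨G', i', δ'', ?_, htri''⟩
  have hδ : δ'' = 0 := by
    have h := congr(σ ≫ $(distTriang_comp₂₃ htri''))
    rwa [← Category.assoc, hσs, Category.id_comp, comp_zero] at h
  -- Since `σ` splits `s'`, the fiber `G'` is a direct summand of `X'`.
  obtain ⟨p, hp⟩ : ∃ p : X' ⟶ G', i' ≫ p = 𝟙 G' := by
    obtain ⟨p, hp⟩ := distTriang_exists_lift₂ htri'' (𝟙 X' - s' ≫ σ)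
      (by rw [Preadditive.sub_comp, Category.assoc, hσs]; simp)
    have : Mono i' := Triangle.mono₁ _ htri'' hδ
    refine ⟨p, ?_⟩
    rw [← cancel_mono i', Category.assoc, ← hp, Preadditive.comp_sub,
      reassoc_of% (distTriang_comp₁₂ htri'')]
    simp
  rw [t.le_iff_isLE, t.isLE_iff_orthogonal 0 1 rfl]
  intro Y k hY
  have hY' : t.ge 1 Y := hY.ge
  -- A test map on `G'` extends to `y` on `X'`. There `y` agrees with `s' ≫ m` up to a map from
  -- `L⟦1⟧ ≤ 0` to `Y ≥ 1`, which is zero; and `s' ≫ m` vanishes on `G'`.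
  obtain ⟨y, hy⟩ : ∃ y : X' ⟶ Y, i' ≫ y = k := ⟨p ≫ k, by rw [reassoc_of% hp]⟩
  obtain ⟨m, hm⟩ : ∃ m : T ⟶ Y, j ≫ y = s ≫ m := ⟨σ ≫ y, by rw [hσ, Category.assoc]⟩
  have h0 : j ≫ (y - s' ≫ m) = 0 := by
    rw [Preadditive.comp_sub, hm, ← Category.assoc, ← hs', sub_self]
  obtain ⟨u, hu⟩ := distTriang_exists_desc₃ htri _ h0
  rw [t.zero' u (le_zero_shift_one hL) hY', comp_zero] at hu
  rw [← hy, sub_eq_zero.1 hu, reassoc_of% (distTriang_comp₁₂ htri''), zero_comp]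

end Coaisle

/-! ### The approximation sequence -/

section Step

variable {A₁ : Type u₁} [Category.{v₁} A₁] [Preadditive A₁]
  {A₂ : Type u₂} [Category.{v₂} A₂] [Preadditive A₂] [HasZeroObject A₂] [HasShift A₂ ℤ]
  [∀ n : ℤ, (shiftFunctor A₂ n).Additive] [Pretriangulated A₂]
  {φ : A₁ ⥤ A₂} {ψ : A₂ ⥤ A₁} (adj : ψ ⊣ φ) {t : TStructure A₂}

include adj in
lemma eq_zero_of_leftAdjoint_obj {G : A₂} {C : A₁} (hG : t.le 0 G) (hC : t.ge 1 (φ.obj C))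
    (k : ψ.obj G ⟶ C) : k = 0 := by
  apply (adj.homEquiv _ _).injective
  exact (t.zero' _ hG hC).trans (t.zero' _ hG hC).symm

variable [HasShift A₁ ℤ] [∀ n : ℤ, (shiftFunctor A₁ n).Additive] [φ.CommShift ℤ]

include adj in
lemma eq_zero_of_shift_leftAdjoint_obj {G : A₂} {C : A₁} (hG : t.le 0 G)
    (hC : t.ge 0 (φ.obj C)) (k : (ψ.obj G)⟦(1 : ℤ)⟧ ⟶ C) : k = 0 := by
  apply (shiftOneHomEquiv _ _).injective
  rw [shiftOneHomEquiv_zero]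
  refine eq_zero_of_leftAdjoint_obj adj (t := t) hG ?_ _
  exact (t.ge 1).prop_of_iso ((φ.commShiftIso (-1 : ℤ)).app C).symm
    (t.ge_shift 0 (-1) 1 (by lia) _ hC)

variable [HasZeroObject A₁] [Pretriangulated A₁] [φ.IsTriangulated]

include adj in
/-- One step of the approximation of the coaisle induced by `φ`: cone off
`ψ (τ_{≤ 0} (φ F)) ⟶ F`. -/
lemma exists_approximation_step (hexact : IsRightTExact (ψ ⋙ φ) t t) {T : A₂} (hT : t.ge 1 T)
    (F : A₁) (s : φ.obj F ⟶ T) (hs : HasConnectiveFiber t s) :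
    ∃ (F' : A₁) (j : F ⟶ F') (s' : φ.obj F' ⟶ T) (σ : T ⟶ φ.obj F'),
      HasConnectiveFiber t s' ∧ φ.map j = s ≫ σ ∧ σ ≫ s' = 𝟙 T ∧
      (∀ C, t.ge 0 (φ.obj C) → ∀ k : F' ⟶ C, j ≫ k = 0 → k = 0) ∧
      (∀ C, t.ge 1 (φ.obj C) → ∀ k : F ⟶ C, ∃ k', j ≫ k' = k) := by
  obtain ⟨G, i, δ, hG, htri⟩ := id hs
  let ℓ : ψ.obj G ⟶ F := (adj.homEquiv _ _).symm i
  have hℓ : adj.unit.app G ≫ φ.map ℓ = i :=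
    (Adjunction.homEquiv_unit _ _ _ _).symm.trans (Equiv.apply_symm_apply _ _)
  obtain ⟨F', j, δF, htriF⟩ := distinguished_cocone_triangle ℓ
  have htri' := distTriang_map htriF φ
  have hij : i ≫ φ.map j = 0 := by
    rw [← hℓ, Category.assoc, ← φ.map_comp, distTriang_comp₁₂ htriF, φ.map_zero, comp_zero]
  -- Every map from an object `≤ 0` to `φ F` factors through `G`, because `T ≥ 1`; `φ j` therefore
  -- kills all of them.
  obtain ⟨s', σ, h1, h2, h3⟩ := hs.exists_of_cone hT (hexact G hG) htri' (by
    intro G' i' hG'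
    obtain ⟨u, rfl⟩ := distTriang_exists_lift₂ htri i' (t.zero' _ hG' hT)
    rw [Category.assoc, hij, comp_zero])
  refine ⟨F', j, s', σ, h1, h2, h3, fun C hC k hk => ?_, fun C hC k => ?_⟩
  · obtain ⟨u, hu⟩ := distTriang_exists_desc₃ htriF k hk
    rw [hu, eq_zero_of_shift_leftAdjoint_obj adj hG hC u, comp_zero]
  · obtain ⟨u, hu⟩ := distTriang_exists_desc₂ htriF k (eq_zero_of_leftAdjoint_obj adj hG hC _)
    exact ⟨u, hu.symm⟩

include adj in
/-- The iterated approximation, together with its essentially constant image under `φ`. -/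
lemma exists_approximation_sequence (hexact : IsRightTExact (ψ ⋙ φ) t t) {T : A₂}
    (hT : t.ge 1 T) (x : Σ F : A₁, φ.obj F ⟶ T) (hx : HasConnectiveFiber t x.2) :
    ∃ (S : ℕ → Σ F : A₁, φ.obj F ⟶ T) (j : ∀ n, (S n).1 ⟶ (S (n + 1)).1)
      (σ : ∀ n, T ⟶ φ.obj (S (n + 1)).1), S 0 = x ∧
      (∀ n, φ.map (j n) = (S n).2 ≫ σ n) ∧ (∀ n, σ n ≫ (S (n + 1)).2 = 𝟙 T) ∧
      (∀ C, t.ge 0 (φ.obj C) → ∀ n (k : (S (n + 1)).1 ⟶ C), j n ≫ k = 0 → k = 0) ∧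
      (∀ C, t.ge 1 (φ.obj C) → ∀ n (k : (S n).1 ⟶ C), ∃ k', j n ≫ k' = k) := by
  choose F' j s' σ h1 h2 h3 h4 h5 using exists_approximation_step adj hexact hT
  -- The connective fiber is carried along in a subtype, since each step needs it as input.
  let next (y : {y : Σ F : A₁, φ.obj F ⟶ T // HasConnectiveFiber t y.2}) :
      {y : Σ F : A₁, φ.obj F ⟶ T // HasConnectiveFiber t y.2} :=
    ⟨⟨F' y.1.1 y.1.2 y.2, s' y.1.1 y.1.2 y.2⟩, h1 _ _ _⟩
  let S (n : ℕ) : {y : Σ F : A₁, φ.obj F ⟶ T // HasConnectiveFiber t y.2} :=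
    Nat.rec ⟨x, hx⟩ (fun _ y => next y) n
  exact ⟨fun n => (S n).1, fun n => j _ _ (S n).2, fun n => σ _ _ (S n).2, rfl,
    fun n => h2 _ _ _, fun n => h3 _ _ _, fun C hC n => h4 _ _ _ C hC,
    fun C hC n => h5 _ _ _ C hC⟩

end Step

/-! ### Truncation triangles from the homotopy colimit -/

section Approximation

lemma hasColimitsOfShape_discrete_nat (C : Type u₁) [Category.{v₁} C] [HasCoproducts.{w} C] :
    HasColimitsOfShape (Discrete ℕ) C :=
  hasColimitsOfShape_of_equivalence (Discrete.equivalence (Equiv.ulift.{w} (α := ℕ)))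

lemma preservesColimitsOfShape_discrete_nat {C : Type u₁} [Category.{v₁} C]
    {D : Type u₂} [Category.{v₂} D] (Φ : C ⥤ D)
    [∀ J : Type w, PreservesColimitsOfShape (Discrete J) Φ] :
    PreservesColimitsOfShape (Discrete ℕ) Φ :=
  preservesColimitsOfShape_of_equiv (Discrete.equivalence (Equiv.ulift.{w} (α := ℕ))) Φ

lemma ge_map_shift {A₁ : Type u₁} [Category.{v₁} A₁] [HasShift A₁ ℤ]
    {A₂ : Type u₂} [Category.{v₂} A₂] [Preadditive A₂] [HasZeroObject A₂] [HasShift A₂ ℤ]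
    [∀ n : ℤ, (shiftFunctor A₂ n).Additive] [Pretriangulated A₂] (φ : A₁ ⥤ A₂) [φ.CommShift ℤ]
    (t : TStructure A₂) (a n n' : ℤ) (h : a + n' = n) {C : A₁} (hC : t.ge n (φ.obj C)) :
    t.ge n' (φ.obj (C⟦a⟧)) :=
  (t.ge n').prop_of_iso ((φ.commShiftIso a).app C).symm (t.ge_shift n a n' h _ hC)

variable {D₁ : Type u₁} [Category.{v₁} D₁] [Preadditive D₁] [HasZeroObject D₁] [HasShift D₁ ℤ]
  [∀ n : ℤ, (shiftFunctor D₁ n).Additive] [Pretriangulated D₁]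
  {D₂ : Type u₂} [Category.{v₂} D₂] [Preadditive D₂] [HasZeroObject D₂] [HasShift D₂ ℤ]
  [∀ n : ℤ, (shiftFunctor D₂ n).Additive] [Pretriangulated D₂]

/-- The homotopy colimit of a sequence whose image under `Φ` factors as an essentially constant
system with value `T`. -/
lemma exists_telescope (Φ : D₁ ⥤ D₂) [Φ.CommShift ℤ] [Φ.IsTriangulated]
    [HasColimitsOfShape (Discrete ℕ) D₁] [PreservesColimitsOfShape (Discrete ℕ) Φ]
    {X : ℕ → D₁} (j : ∀ n, X n ⟶ X (n + 1)) {T : D₂} (s : ∀ n, Φ.obj (X n) ⟶ T)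
    (σ : ∀ n, T ⟶ Φ.obj (X (n + 1)))
    (hj : ∀ n, Φ.map (j n) = s n ≫ σ n) (hσ : ∀ n, σ n ≫ s (n + 1) = 𝟙 T) :
    ∃ (B : D₁) (p : X 0 ⟶ B) (e : Φ.obj B ≅ T), Φ.map p ≫ e.hom = s 0 ∧
      (∀ C, (∀ n (k : X n ⟶ C), ∃ k', j n ≫ k' = k) → ∀ k : X 0 ⟶ C, ∃ u, p ≫ u = k) ∧
      (∀ C, (∀ n (k : X (n + 1) ⟶ C), j n ≫ k = 0 → k = 0) →
        (∀ n (k : X n ⟶ C⟦(-1 : ℤ)⟧), ∃ k', j n ≫ k' = k) →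
        ∀ u : B ⟶ C, p ≫ u = 0 → u = 0) := by
  let c : Cofan X := Cofan.mk (∐ X) (Sigma.ι X)
  have hc : IsColimit c := coproductIsCoproduct X
  let f : c.pt ⟶ c.pt := Cofan.IsColimit.desc hc fun n => c.inj n - j n ≫ c.inj (n + 1)
  have hf (n : ℕ) : c.inj n ≫ f = c.inj n - j n ≫ c.inj (n + 1) := Cofan.IsColimit.fac hc _ n
  obtain ⟨B, g, h, hT⟩ := distinguished_cocone_triangle f
  let c' : Cofan fun n => Φ.obj (X n) := Cofan.mk (Φ.obj c.pt) fun n => Φ.map (c.inj n)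
  have hc' : IsColimit c' := isColimitCofanMkObjOfIsColimit Φ X c.inj hc
  have hf' (n : ℕ) : c'.inj n ≫ Φ.map f = c'.inj n - Φ.map (j n) ≫ c'.inj (n + 1) := by
    have := Φ.congr_map (hf n)
    rwa [Φ.map_comp, Φ.map_sub, Φ.map_comp] at this
  obtain ⟨e, he⟩ := telescope_iso_of_factors hc' hf' (distTriang_map hT Φ) s σ hj hσ
  refine ⟨B, c.inj 0 ≫ g, e, ?_, fun C hs => telescope_exists_extension hc hf hT hs,
    fun C hi hs => telescope_eq_zero hc hf hT hi hs⟩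
  rw [Φ.map_comp]; exact he

variable {P₁ : ObjectProperty D₁} [P₁.IsTriangulated] {P₂ : ObjectProperty D₂}
  [P₂.IsTriangulated] [P₂.IsClosedUnderIsomorphisms]

/-- Every object of `P₁` is an extension of an object of the coaisle induced by `Φ` by an object
that is left orthogonal to this coaisle. -/
theorem exists_triangle_of_adjunction [HasCoproducts.{w} D₁] (Φ : D₁ ⥤ D₂) [Φ.CommShift ℤ]
    [Φ.IsTriangulated] [∀ J : Type w, PreservesColimitsOfShape (Discrete J) Φ]
    (Ψ : D₂ ⥤ D₁) (adj : Ψ ⊣ Φ)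
    (hΦ : ∀ F, P₁ F → P₂ (Φ.obj F)) (hΨ : ∀ G, P₂ G → P₁ (Ψ.obj G))
    (hpre : ∀ F, P₂ (Φ.obj F) → P₁ F) (t : TStructure P₂.FullSubcategory)
    (hexact : IsRightTExact (restrict Ψ hΨ ⋙ restrict Φ hΦ) t t) (F : P₁.FullSubcategory) :
    ∃ (A B : P₁.FullSubcategory) (i : A ⟶ F) (p : F ⟶ B) (δ : B ⟶ A⟦(1 : ℤ)⟧),
      Triangle.mk i p δ ∈ distTriang _ ∧ t.le 0 ((restrict Φ hΦ).obj A) ∧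
      t.ge 1 ((restrict Φ hΦ).obj B) ∧
      ∀ C, t.ge 1 ((restrict Φ hΦ).obj C) → ∀ k : A ⟶ C, k = 0 := by
  have := hasColimitsOfShape_discrete_nat.{w} D₁
  have := preservesColimitsOfShape_discrete_nat.{w} Φ
  let φ := restrict Φ hΦ
  let adj' : restrict Ψ hΨ ⊣ φ := adj.restrictFullyFaithful P₂.fullyFaithfulι P₁.fullyFaithfulι
    (Iso.refl _) (Iso.refl _)
  obtain ⟨G, T, hG, hT, i, s, δ, htri⟩ := t.exists_triangle_zero_one (φ.obj F)
  obtain ⟨S, j, σ, hS, hj, hσ, hinj, hsurj⟩ := exists_approximation_sequence adj' hexact hT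
    ⟨F, s⟩ ⟨G, i, δ, hG, htri⟩
  have hS' : HasConnectiveFiber t (S 0).2 := by rw [hS]; exact ⟨G, i, δ, hG, htri⟩
  obtain rfl : F = (S 0).1 := by rw [hS]
  obtain ⟨B, p, e, hpe, hext, hzero⟩ := exists_telescope Φ (X := fun n => (S n).1.obj)
    (fun n => P₁.ι.map (j n)) (fun n => P₂.ι.map (S n).2) (fun n => P₂.ι.map (σ n))
    (fun n => (P₂.ι.congr_map (hj n)).trans (P₂.ι.map_comp _ _))
    (fun n => (P₂.ι.map_comp _ _).symm.trans (P₂.ι.congr_map (hσ n)))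
  -- The homotopy colimit lives only in `D₁`; it is in `P₁` because `Φ B ≅ T` lies in `P₂` and `P₁`
  -- contains the preimage of `P₂`.
  let B' : P₁.FullSubcategory := ⟨B, hpre B (P₂.prop_of_iso e.symm T.property)⟩
  let p' : (S 0).1 ⟶ B' := P₁.homMk p
  let e' : φ.obj B' ≅ T := P₂.isoMk e
  have hpe' : φ.map p' ≫ e'.hom = (S 0).2 := P₂.ι.map_injective hpe
  have hext' (C : P₁.FullSubcategory) (hC : t.ge 1 (φ.obj C)) (k : (S 0).1 ⟶ C) :
      ∃ u, p' ≫ u = k := by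
    obtain ⟨u, hu⟩ := hext C.obj (fun n k => by
      obtain ⟨k', hk'⟩ := hsurj C hC n (P₁.homMk k)
      exact ⟨k'.hom, P₁.ι.congr_map hk'⟩) k.hom
    exact ⟨P₁.homMk u, P₁.ι.map_injective hu⟩
  have hzero' (C : P₁.FullSubcategory) (hC : t.ge 0 (φ.obj C)) (u : B' ⟶ C) (hu : p' ≫ u = 0) :
      u = 0 := by
    refine P₁.ι.map_injective (hzero C.obj (fun n k hk => ?_) (fun n k => ?_) u.hom
      (P₁.ι.congr_map hu))
    · exact P₁.ι.congr_map (hinj C hC n (P₁.homMk k) (P₁.ι.map_injective hk))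
    · let e₁ : C.obj⟦(-1 : ℤ)⟧ ≅ (C⟦(-1 : ℤ)⟧).obj := ((P₁.ι.commShiftIso (-1 : ℤ)).app C).symm
      obtain ⟨k', hk'⟩ := hsurj (C⟦(-1 : ℤ)⟧)
        (ge_map_shift φ t (-1) 0 1 (by lia) hC) n (P₁.homMk (k ≫ e₁.hom))
      refine ⟨k'.hom ≫ e₁.inv, ?_⟩
      have : (j n).hom ≫ k'.hom = k ≫ e₁.hom := P₁.ι.congr_map hk'
      change (j n).hom ≫ k'.hom ≫ e₁.inv = k
      rw [reassoc_of% this, e₁.hom_inv_id, Category.comp_id]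
  obtain ⟨A, a, δA, hA⟩ := distinguished_cocone_triangle₁ p'
  refine ⟨A, B', a, p', δA, hA, ?_, (t.ge 1).prop_of_iso e'.symm hT, fun C hC k => ?_⟩
  · exact (hS'.of_iso e' hpe').le_of_distTriang (distTriang_map hA φ)
  -- The shift `C⟦1⟧` is only `≥ 0` after `φ`, which is why injectivity on maps out of `B'` was
  -- established for that larger class. Then `k` extends along `a` to `F`, and that extension
  -- factors through `p'`, while `a ≫ p' = 0`.
  · have h0 : δA ≫ k⟦(1 : ℤ)⟧' = 0 := by
      refine hzero' _ (ge_map_shift φ t 1 1 0 (by lia) hC) _ ?_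
      rw [reassoc_of% (distTriang_comp₂₃ hA), zero_comp]
    obtain ⟨v, hv⟩ := distTriang_exists_desc₁ hA _ h0
    obtain ⟨v, rfl⟩ := (shiftFunctor P₁.FullSubcategory (1 : ℤ)).map_surjective v
    have hk : k = a ≫ v :=
      (shiftFunctor _ (1 : ℤ)).map_injective (hv.trans (Functor.map_comp _ _ _).symm)
    obtain ⟨u, rfl⟩ := hext' C hC v
    rw [hk, reassoc_of% (distTriang_comp₁₂ hA), zero_comp]

end Approximation

/-! ### Uniqueness of the t-structure -/

section Uniqueness

variable {A : Type u₁} [Category.{v₁} A] [Preadditive A] [HasZeroObject A] [HasShift A ℤ]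
  [∀ n : ℤ, (shiftFunctor A n).Additive] [Pretriangulated A]

/-- A t-structure is determined by the objects that are `≥ 0`. -/
lemma tStructure_ext_of_ge_zero {t t' : TStructure A} (h : ∀ X, t.ge 0 X ↔ t'.ge 0 X) :
    t = t' := by
  have hge : t.ge = t'.ge := by
    ext n X
    rw [t.ge_iff_isGE, t'.ge_iff_isGE, ← t.isGE_shift_iff X n n 0 (by lia),
      ← t'.isGE_shift_iff X n n 0 (by lia), ← t.ge_iff_isGE, ← t'.ge_iff_isGE, h]
  have hle : t.le = t'.le := by
    ext n X
    rw [t.le_iff_isLE, t'.le_iff_isLE, t.isLE_iff_orthogonal n (n + 1) rfl,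
      t'.isLE_iff_orthogonal n (n + 1) rfl]
    simp only [← TStructure.ge_iff_isGE, hge]
  cases t; cases t'
  subst hge hle
  rfl

end Uniqueness

/-! ### The induced t-structure -/

section Induced

variable {A₁ : Type u₁} [Category.{v₁} A₁] [Preadditive A₁] [HasShift A₁ ℤ]
  [∀ n : ℤ, (shiftFunctor A₁ n).Additive]
  {A₂ : Type u₂} [Category.{v₂} A₂] [Preadditive A₂] [HasZeroObject A₂] [HasShift A₂ ℤ]
  [∀ n : ℤ, (shiftFunctor A₂ n).Additive] [Pretriangulated A₂]

/-- The objects of `A₁` that are left orthogonal to the objects sent to `A₂^{> n}` by `φ`. -/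
def inducedLE (φ : A₁ ⥤ A₂) (t : TStructure A₂) (n : ℤ) : ObjectProperty A₁ :=
  fun X => ∀ Y, t.ge (n + 1) (φ.obj Y) → ∀ k : X ⟶ Y, k = 0

instance (φ : A₁ ⥤ A₂) (t : TStructure A₂) (n : ℤ) :
    (inducedLE φ t n).IsClosedUnderIsomorphisms where
  of_iso e h Y hY k := by rw [← cancel_epi e.hom, h Y hY (e.hom ≫ k), comp_zero]

lemma inducedLE_shift (φ : A₁ ⥤ A₂) [φ.CommShift ℤ] (t : TStructure A₂) (n a n' : ℤ)
    (h : a + n' = n) (X : A₁) (hX : inducedLE φ t n X) : inducedLE φ t n' (X⟦a⟧) := by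
  intro Y hY k
  have h0 : (shiftShiftNeg X a).inv ≫ k⟦-a⟧' = 0 :=
    hX _ (ge_map_shift φ t (-a) (n' + 1) (n + 1) (by lia) hY) _
  apply (shiftFunctor A₁ (-a)).map_injective
  rw [← cancel_epi (shiftShiftNeg X a).inv, h0, Functor.map_zero, comp_zero]

variable [HasZeroObject A₁] [Pretriangulated A₁]

/-- Existence of the truncation triangles for the coaisle `φ⁻¹(A₂^{≥ 1})`, where in addition the
truncation `A ≤ 0` is sent to `A₂^{≤ 0}`. -/
def HasInducedTruncations (φ : A₁ ⥤ A₂) (t : TStructure A₂) : Prop :=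
  ∀ F : A₁, ∃ (A B : A₁) (i : A ⟶ F) (p : F ⟶ B) (δ : B ⟶ A⟦(1 : ℤ)⟧),
    Triangle.mk i p δ ∈ distTriang _ ∧ t.le 0 (φ.obj A) ∧ t.ge 1 (φ.obj B) ∧
      ∀ C, t.ge 1 (φ.obj C) → ∀ k : A ⟶ C, k = 0

variable {φ : A₁ ⥤ A₂} [φ.CommShift ℤ] {t : TStructure A₂} (H : HasInducedTruncations φ t)

/-- The t-structure whose coaisle is the preimage under `φ` of the coaisle of `t`. -/
def inducedTStructure : TStructure A₁ where
  le n := inducedLE φ t n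
  ge n := (t.ge n).inverseImage φ
  le_shift := inducedLE_shift φ t
  ge_shift n a n' h X hX := ge_map_shift φ t a n n' h hX
  zero' X Y f hX hY := hX Y hY f
  le_zero_le X hX Y hY := hX Y (t.ge_antitone (by lia) _ hY)
  ge_one_le X hX := t.ge_one_le _ hX
  exists_triangle_zero_one F := by
    obtain ⟨A, B, i, p, δ, hT, -, hB, hA⟩ := H F
    exact ⟨A, B, hA, hB, i, p, δ, hT⟩

lemma le_zero_of_retract {X Y : A₂} (r : Y ⟶ X) (s : X ⟶ Y) (h : s ≫ r = 𝟙 X) (hY : t.le 0 Y) :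
    t.le 0 X := by
  rw [t.le_iff_isLE, t.isLE_iff_orthogonal 0 1 rfl]
  intro Z k hZ
  rw [← Category.id_comp k, ← h, Category.assoc, t.zero' (r ≫ k) hY hZ.ge, comp_zero]

/-- For right exactness: if `F` is left orthogonal to the coaisle, then `F ⟶ B` vanishes, so `F` is
a retract of its truncation `A`, and `φ A ≤ 0`. -/
lemma isTExact_inducedTStructure : IsTExact φ (inducedTStructure H) t := by
  refine ⟨fun X hX => hX, fun F hF => ?_⟩
  obtain ⟨A, B, i, p, δ, hT, hA, hB, -⟩ := H F
  obtain ⟨s, hs⟩ := distTriang_exists_lift₂ hT (𝟙 F)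
    (by rw [Category.id_comp]; exact hF B hB p)
  exact le_zero_of_retract (φ.map i) (φ.map s) (by rw [← φ.map_comp, ← hs, φ.map_id]) hA

/-- When `φ F ≤ 0`, the map `φ F ⟶ φ B` is zero, so the identity of `φ B ≥ 1` factors through `(φ
A)⟦1⟧ ≤ 0` and vanishes. Hence `B = 0` and `F` is a retract of `A`. -/
lemma inducedTStructure_le_zero_iff [φ.IsTriangulated] (hφ : ∀ F, IsZero (φ.obj F) → IsZero F) (F : A₁) :
    (inducedTStructure H).le 0 F ↔ t.le 0 (φ.obj F) := by
  refine ⟨(isTExact_inducedTStructure H).2 F, fun hF => ?_⟩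
  obtain ⟨A, B, i, p, δ, hT, hA, hB, hAle⟩ := H F
  have hT' := distTriang_map hT φ
  obtain ⟨k, hk⟩ := distTriang_exists_desc₃ hT' (𝟙 (φ.obj B))
    (by rw [Category.comp_id]; exact t.zero' _ hF hB)
  have hB0 : IsZero B := hφ B <| (IsZero.iff_id_eq_zero _).2 <| by
    rw [hk, t.zero' k (le_zero_shift_one hA) hB, comp_zero]
  obtain ⟨s, hs⟩ := distTriang_exists_lift₂ hT (𝟙 F) (hB0.eq_of_tgt _ _)
  intro C hC k
  rw [← Category.id_comp k, hs, Category.assoc, hAle C hC (i ≫ k), comp_zero]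

end Induced

/-! ### Monomorphisms and chains in the hearts -/

section Noetherian

variable {A₁ : Type u₁} [Category.{v₁} A₁] [Preadditive A₁] [HasZeroObject A₁] [HasShift A₁ ℤ]
  [∀ n : ℤ, (shiftFunctor A₁ n).Additive] [Pretriangulated A₁]
  {t₁ : TStructure A₁}

/-- The cone of a monomorphism in the heart is `≥ 0`. -/
lemma ge_zero_of_mono {X Y : t₁.heart.FullSubcategory} (f : X ⟶ Y) [Mono f] {Z : A₁}
    {g : Y.obj ⟶ Z} {h : Z ⟶ X.obj⟦(1 : ℤ)⟧} (hT : Triangle.mk f.hom g h ∈ distTriang A₁) :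
    t₁.ge 0 Z := by
  obtain ⟨N, Q, hN, hQ, i, p, δ, hT'⟩ := t₁.exists_triangle Z (-1) 0 (by lia)
  have hXs : t₁.ge (-1) (X.obj⟦(1 : ℤ)⟧) := t₁.ge_shift 0 1 (-1) (by lia) _ X.property.2
  have hZ : t₁.IsGE Z (-1) := t₁.isGE₂ _ (rot_of_distTriang _ hT) (-1)
    ⟨t₁.ge_antitone (by lia : (-1 : ℤ) ≤ 0) _ Y.property.2⟩ ⟨hXs⟩
  have hQs : t₁.ge 1 (Q⟦(-1 : ℤ)⟧) := t₁.ge_shift 0 (-1) 1 (by lia) _ hQ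
  have hNge : t₁.ge (-1) N := (t₁.isGE₂ _ (inv_rot_of_distTriang _ hT') (-1)
    ⟨t₁.ge_antitone (by lia : (-1 : ℤ) ≤ 1) _ hQs⟩ hZ).ge
  -- With `N` the part of the cone in degree `-1`, `M` plays the role of the kernel of `f`, so its
  -- map to `X` vanishes. Then `i` lifts to `Y ≥ 0` and is zero because `N ≤ -1`.
  let M : t₁.heart.FullSubcategory := ⟨N⟦(-1 : ℤ)⟧,
    t₁.le_shift (-1) (-1) 0 (by lia) _ hN, t₁.ge_shift (-1) (-1) 0 (by lia) _ hNge⟩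
  have hih : i ≫ h = 0 := by
    let e : M.obj⟦(1 : ℤ)⟧ ≅ N := shiftNegShift N 1
    obtain ⟨m, hm⟩ := (shiftFunctor A₁ (1 : ℤ)).map_surjective (e.hom ≫ i ≫ h)
    have hmf : m ≫ f.hom = 0 := by
      apply (shiftFunctor A₁ (1 : ℤ)).map_injective
      rw [Functor.map_comp, hm, Category.assoc, Category.assoc, distTriang_comp₃₁ hT,
        comp_zero, comp_zero, Functor.map_zero]
    let m' : M ⟶ X := t₁.heart.homMk m
    have hm' : m' = 0 := by
      rw [← cancel_mono f, zero_comp]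
      exact t₁.heart.ι.map_injective hmf
    have hm0 : m = 0 := congr_arg (fun k => t₁.heart.ι.map k) hm'
    rw [← cancel_epi e.hom, ← hm, hm0, Functor.map_zero, comp_zero]
  have hi : i = 0 := by
    obtain ⟨k, hk⟩ := distTriang_exists_lift₃ hT i hih
    rw [hk, t₁.zero_of_isLE_of_isGE k (-1) 0 (by lia) ⟨hN⟩ ⟨Y.property.2⟩, zero_comp]
  rw [t₁.ge_iff_isGE, t₁.isGE_iff_orthogonal (-1) 0 (by lia)]
  intro W k hW
  obtain ⟨l, hl⟩ := distTriang_exists_lift₂ hT' k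
    (t₁.zero_of_isLE_of_isGE _ (-1) 0 (by lia) hW ⟨hQ⟩)
  rw [hl, hi, comp_zero]

variable {A₂ : Type u₂} [Category.{v₂} A₂] [Preadditive A₂] [HasZeroObject A₂] [HasShift A₂ ℤ]
  [∀ n : ℤ, (shiftFunctor A₂ n).Additive] [Pretriangulated A₂]
  {t₂ : TStructure A₂} {φ : A₁ ⥤ A₂}

/-- The functor between the hearts that is induced by a t-exact functor. -/
abbrev heartFunctor (hφ : IsTExact φ t₁ t₂) :
    t₁.heart.FullSubcategory ⥤ t₂.heart.FullSubcategory :=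
  restrict φ fun X hX => ⟨hφ.2 X hX.1, hφ.1 X hX.2⟩

variable [φ.CommShift ℤ] [φ.IsTriangulated]

/-- The cone of a monomorphism is `≥ 0`, and stays so under `φ`. A map `k` killed by `φ f` gives,
after shifting, a map from `W⟦1⟧ ≤ -1` that lifts to this cone, so it is zero. -/
lemma heartFunctor_preservesMonomorphisms (hφ : IsTExact φ t₁ t₂) :
    (heartFunctor hφ).PreservesMonomorphisms where
  preserves {X Y} f _ := by
    obtain ⟨Z, g, h, hT⟩ := distinguished_cocone_triangle f.hom
    have hZ := hφ.1 _ (ge_zero_of_mono f hT)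
    have hT' := distTriang_map hT φ
    refine Preadditive.mono_of_cancel_zero _ fun {W} k hk => ?_
    have hk' : k.hom ≫ φ.map f.hom = 0 := congr_arg (fun k => t₂.heart.ι.map k) hk
    have h0 : (k.hom)⟦(1 : ℤ)⟧' ≫ (φ.map f.hom)⟦(1 : ℤ)⟧' = 0 := by
      rw [← Functor.map_comp, hk', Functor.map_zero]
    obtain ⟨l, hl⟩ := distTriang_exists_lift₁ hT' _ h0
    have hl0 : l = 0 := t₂.zero_of_isLE_of_isGE l (-1) 0 (by lia)
      ⟨t₂.le_shift 0 1 (-1) (by lia) _ W.property.1⟩ ⟨hZ⟩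
    apply t₂.heart.ι.map_injective
    apply (shiftFunctor A₂ (1 : ℤ)).map_injective
    refine hl.trans ?_
    rw [hl0, zero_comp]
    exact (Functor.map_zero _ _ _).symm

lemma isIso_of_isIso_map (hzero : ∀ F, IsZero (φ.obj F) → IsZero F) {X Y : A₁} (f : X ⟶ Y)
    [IsIso (φ.map f)] : IsIso f := by
  obtain ⟨Z, g, h, hT⟩ := distinguished_cocone_triangle f
  exact (Triangle.isZero₃_iff_isIso₁ _ hT).1 <| hzero Z <|
    Triangle.isZero₃_of_isIso₁ _ (distTriang_map hT φ) (inferInstanceAs (IsIso (φ.map f)))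

/-- The Noetherian property of the heart is reflected by t-exact functors that reflect zero
objects. -/
theorem isNoetherian_of_isTExact (hφ : IsTExact φ t₁ t₂)
    (hzero : ∀ F, IsZero (φ.obj F) → IsZero F) (h : IsNoetherian t₂) : IsNoetherian t₁ := by
  intro X
  have := heartFunctor_preservesMonomorphisms hφ
  have := h ((heartFunctor hφ).obj X)
  rw [isNoetherianObject_iff_not_strictMono]
  intro S hS
  refine not_strictMono_of_isNoetherianObject
    (fun n => Subobject.mk ((heartFunctor hφ).map (S n).arrow)) (strictMono_nat_of_lt_succ ?_)
  intro n
  have hlt := hS (Nat.lt_succ_self n)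
  let f := Subobject.ofLE (S n) (S (n + 1)) hlt.le
  -- Strictness survives because an inclusion that becomes invertible under `φ` has zero cone, hence
  -- was already invertible.
  refine Subobject.mk_lt_mk_of_comm ((heartFunctor hφ).map f) ?_ fun hiso => ?_
  · rw [← Functor.map_comp, Subobject.ofLE_arrow]
  · have h1 : IsIso (φ.map f.hom) :=
      inferInstanceAs (IsIso (t₂.heart.ι.map ((heartFunctor hφ).map f)))
    have h2 : IsIso (t₁.heart.ι.map f) := isIso_of_isIso_map hzero f.hom
    have h3 : IsIso f := isIso_of_fully_faithful t₁.heart.ι f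
    exact hlt.ne (Subobject.eq_of_comm (asIso f) (Subobject.ofLE_arrow _))

end Noetherian

end InducedTStructure

theorem mainTheorem4
    -- the big triangulated categories, with all small coproducts
    {D₁ : Type u₁} [Category.{v₁} D₁] [Preadditive D₁] [HasZeroObject D₁] [HasShift D₁ ℤ]
    [∀ n : ℤ, (shiftFunctor D₁ n).Additive] [Pretriangulated D₁] [IsTriangulated D₁]
    {D₂ : Type u₂} [Category.{v₂} D₂] [Preadditive D₂] [HasZeroObject D₂] [HasShift D₂ ℤ]
    [∀ n : ℤ, (shiftFunctor D₂ n).Additive] [Pretriangulated D₂] [IsTriangulated D₂]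
    [HasCoproducts.{w} D₁] [HasCoproducts.{w} D₂]
    -- the full triangulated essentially small subcategories
    (P₁ : ObjectProperty D₁) [P₁.IsTriangulated] [EssentiallySmall.{w} P₁.FullSubcategory]
    (P₂ : ObjectProperty D₂) [P₂.IsTriangulated] [P₂.IsClosedUnderIsomorphisms]
    [EssentiallySmall.{w} P₂.FullSubcategory]
    -- the exact functor commuting with small coproducts, and its left adjoint
    (Φ : D₁ ⥤ D₂) [Φ.CommShift ℤ] [Φ.IsTriangulated]
    [∀ J : Type w, PreservesColimitsOfShape (Discrete J) Φ]
    (Ψ : D₂ ⥤ D₁) (adj : Ψ ⊣ Φ)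
    (hΦ : ∀ F, P₁ F → P₂ (Φ.obj F)) (hΨ : ∀ G, P₂ G → P₁ (Ψ.obj G))
    -- the subcategory `P₁` is the whole preimage of `P₂`
    (hpre : ∀ F, P₂ (Φ.obj F) → P₁ F)
    (t₂ : TStructure P₂.FullSubcategory)
    (hexact : InducedTStructure.IsRightTExact
      (InducedTStructure.restrict Ψ hΨ ⋙ InducedTStructure.restrict Φ hΦ) t₂ t₂) :
    ∃ t₁ : TStructure P₁.FullSubcategory,
      (∀ F, t₁.ge 0 F ↔ t₂.ge 0 ((InducedTStructure.restrict Φ hΦ).obj F)) ∧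
      (∀ t : TStructure P₁.FullSubcategory,
        (∀ F, t.ge 0 F ↔ t₂.ge 0 ((InducedTStructure.restrict Φ hΦ).obj F)) → t = t₁) ∧
      InducedTStructure.IsTExact (InducedTStructure.restrict Φ hΦ) t₁ t₂ ∧
      ((∀ F, P₁ F → IsZero (Φ.obj F) → IsZero F) →
        (∀ F, t₁.le 0 F ↔ t₂.le 0 ((InducedTStructure.restrict Φ hΦ).obj F)) ∧
        (InducedTStructure.IsNoetherian t₂ → InducedTStructure.IsNoetherian t₁)) := by
  have H : InducedTStructure.HasInducedTruncations (InducedTStructure.restrict Φ hΦ) t₂ :=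
    InducedTStructure.exists_triangle_of_adjunction.{w} Φ Ψ adj hΦ hΨ hpre t₂ hexact
  refine ⟨InducedTStructure.inducedTStructure H, fun F => Iff.rfl,
    fun t ht => InducedTStructure.tStructure_ext_of_ge_zero ht,
    InducedTStructure.isTExact_inducedTStructure H, fun hzero => ?_⟩
  have hzero' (F : P₁.FullSubcategory) (hF : IsZero ((InducedTStructure.restrict Φ hΦ).obj F)) :
      IsZero F := by
    have h := hzero F.obj F.property (P₂.ι.map_isZero hF)
    exact (IsZero.iff_id_eq_zero _).2 (P₁.ι.map_injective (h.eq_of_src _ _))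
  exact ⟨InducedTStructure.inducedTStructure_le_zero_iff H hzero',
    InducedTStructure.isNoetherian_of_isTExact (InducedTStructure.isTExact_inducedTStructure H)
      hzero'⟩
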